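/- Let $k$ be an infinite field, $S=k[x_0,\dots,x_n]$ with homogeneous maximal ideal $\mathfrak m=(x_0,\dots,x_n)$, let $W\subset S$ be an $(r+1)$-dimensional $k$-vector space of forms of the same degree with basis $f_0,\dots,f_r$, and let $I=(f_0,\dots,f_r)\subset S$ be the ideal generated by $W$. Assume that $\operatorname{codim} I\ge 2$. Let $\ell(I)$ denote the analytic spread of $I$, i.e. the Krull dimension of $\mathcal R/\mathfrak m\mathcal R$, where $\mathcal R=S[It]$ is the Rees algebra of $I$ (equivalently, one plus the dimension of the image of the rational map $\mathbf P^n\to\mathbf P^r=\mathbf P(W)$ defined by $W$). Let $q$ be a $k$-rational point of $\mathbf P(W)$, that is, a subspace $W_q\subset W$ of codimension $1$, and let $I_q\subset S$ be the ideal generated by $W_q$; write $I_q:I^\infty=\bigcup_i (I_q:I^i)$. Let $A$ be a matrix with $r+1$ rows and finitely many columns whose entries are homogeneous forms in $S$, each of whose columns is a syzygy on $f_0,\dots,f_r$. View $A$ as a map $S^m\to S\otimes_k W$ and let $A_q\subset S$ be the generalized row ideal of $A$ at $q$, i.e. the image of the composition $S^m\to S\otimes_k W\to S\otimes_k (W/W_q)\cong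 S$. If there exists a prime ideal $P$ of $S$ with $A_q\subset P$ such that the matrix $A\otimes\kappa(P)$ over the residue field $\kappa(P)=S_P/PS_P$ has rank $r$, then $I_q:I^\infty\ne S$ and $$\ell(I)\ \ge\ 1+\operatorname{codim} A_q .$$ -/

import Mathlib

/-- The saturation `J : I^∞ = ⋃ i, (J : I ^ i)` of an ideal `J` with respect to an ideal `I`
(the ideals `J : I ^ i` form an increasing chain, so their supremum is their union). -/
def Ideal.colonInfty {R : Type*} [CommRing R] (J I : Ideal R) : Ideal R :=
  ⨆ i : ℕ, Submodule.colon J ((I ^ i : Ideal R) : Set R)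

/-- Sanity check: `J : I^∞` consists of the elements `x` with `x I ^ i ⊆ J` for some `i`. -/
theorem Ideal.mem_colonInfty {R : Type*} [CommRing R] {J I : Ideal R} {x : R} :
    x ∈ J.colonInfty I ↔ ∃ i : ℕ, ∀ y ∈ I ^ i, x * y ∈ J := by
  have hdir : Directed (· ≤ ·)
      fun i : ℕ => Submodule.colon J ((I ^ i : Ideal R) : Set R) := by
    refine Monotone.directed_le fun i j hij => ?_
    exact Submodule.colon_mono le_rfl (Ideal.pow_le_pow_right hij)
  rw [Ideal.colonInfty, Submodule.mem_iSup_of_directed _ hdir]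
  simp [Submodule.mem_colon]

/-- The special fiber ring `𝓡 ⧸ 𝔪 𝓡` of the Rees algebra `𝓡 = R[It] ⊆ R[t]` of an ideal `I`. -/
abbrev Ideal.SpecialFiberRing {R : Type*} [CommRing R] (m I : Ideal R) : Type _ :=
  reesAlgebra I ⧸ m.map (algebraMap R (reesAlgebra I))

/-- The analytic spread `ℓ(I)` of an ideal `I` with respect to the (homogeneous) maximal
ideal `m`: the Krull dimension of the special fiber ring `𝓡 ⧸ m 𝓡 = ⨁ i, I ^ i ⧸ m I ^ i`. -/
noncomputable def Ideal.analyticSpread {R : Type*} [CommRing R] (m I : Ideal R) : WithBot ℕ∞ :=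
  ringKrullDim (Ideal.SpecialFiberRing m I)

/-- Let `b` be a basis of a vector space `W`, let `Wq` be a subspace of codimension one, and let
`A` be a matrix over the `k`-algebra `S` whose rows are indexed by `b`, viewed as a map
`S ^ ι → S ⊗ W`. The generalized row ideal is the image of the composition
`S ^ ι → S ⊗ W → S ⊗ (W ⧸ Wq) ≅ S`, where the last isomorphism is induced by a nonzero functional
`l` on the line `W ⧸ Wq`: it is generated by the entries `∑ i, l(b i) A i j` of the generalized
row. Since any two nonzero functionals are proportional, all of them may be used at once. -/
def generalizedRowIdeal {k S W ρ ι : Type*} [Field k] [CommRing S] [Algebra k S]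
    [AddCommGroup W] [Module k W] [Fintype ρ] (b : Module.Basis ρ k W) (Wq : Submodule k W)
    (A : Matrix ρ ι S) : Ideal S :=
  Ideal.span {s | ∃ (l : Module.Dual k (W ⧸ Wq)) (j : ι),
    s = ∑ i, l (Wq.mkQ (b i)) • A i j}

/-! Choose `w₀` in $W$ spanning $W/W_q$, and rewrite the syzygies in a basis of $W_q$ together with
`w₀`. The `w₀`-row generates $A_q$, so it vanishes modulo $P$. The rank hypothesis then makes the
remaining $r$ rows right invertible after inverting some `Δ` outside $P$. Hence, locally at $P$,
$W_q \subseteq A_q w_0$ and $I = (w_0)$. If `w₀` lay in $P$, a minimal prime of $(w_0)$ inside $P$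
would contain $I$, contradicting codimension at least 2 by Krull. So `w₀` is a unit at $P$, $I_q$
and $A_q$ agree there, and $I_q : I^\infty \ne S$ follows.

For the bound, take a minimal prime $Q \subseteq P$ of $A_q$; it is also minimal over $I_q$. The
fiber ring is $k[Wt] \subset S[t]$. Let $p = QS[t] \cap k[Wt]$. Since $QS[t]$ is minimal over
$pS[t]$, $p$ has height at least that of $Q$. It is strictly inside the irrelevant ideal because
$w_0 t \notin p$, which gives the extra 1. -/

/-! ### Heights under extension and contraction -/

open Polynomial in
/-- Extending a prime ideal to the polynomial ring does not decrease its height. -/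
lemma Ideal.height_le_height_map_C {R : Type*} [CommRing R] [IsNoetherianRing R] (Q : Ideal R)
    [Q.IsPrime] : Q.height ≤ (Q.map (C : R →+* R[X])).height := by
  have hover : (Q.map (C : R →+* R[X])).LiesOver Q := by
    refine ⟨le_antisymm le_comap_map fun x hx => ?_⟩
    simpa using Ideal.mem_map_C_iff.mp (show C x ∈ Q.map C from hx) 0
  rw [Ideal.height_eq_height_add_of_liesOver_of_hasGoingDown Q (Q.map (C : R →+* R[X]))]
  exact le_self_add

/-- If a prime `q` is a minimal prime of the extension of an ideal contained in its contraction,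
then the height of `q` is at most the height of its contraction. -/
lemma Ideal.height_le_height_comap_of_mem_minimalPrimes {B T : Type*} [CommRing B] [CommRing T]
    [IsNoetherianRing B] [IsNoetherianRing T] [Algebra B T] (q : Ideal T) [q.IsPrime]
    (h : q ∈ ((q.comap (algebraMap B T)).map (algebraMap B T)).minimalPrimes) :
    q.height ≤ (q.comap (algebraMap B T)).height := by
  let p := q.comap (algebraMap B T)
  change q ∈ (p.map (algebraMap B T)).minimalPrimes at h
  change _ ≤ p.height
  have : q.LiesOver p := ⟨rfl⟩
  have hle := Ideal.height_le_height_add_of_liesOver p q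
  -- In ht q ≤ ht p + ht(q/pT), minimality of `q` over pT kills the fibre term.
  suffices h0 : (q.map (Ideal.Quotient.mk (p.map (algebraMap B T)))).height = 0 by
    simpa [h0] using hle
  rw [Ideal.minimalPrimes_eq_comap] at h
  obtain ⟨q', hq', hqq⟩ := h
  rw [← hqq, Ideal.map_comap_of_surjective _ Ideal.Quotient.mk_surjective]
  have := hq'.1.1
  exact Ideal.height_eq_zero_iff.mpr hq'

/-! ### Clearing denominators in a right inverse -/

/-- A matrix of full row rank over the residue field at `P` has a right inverse up to a
denominator outside `P`. -/
lemma Matrix.exists_mul_eq_smul_one_of_rank_residueField {S : Type*} [CommRing S] (P : Ideal S)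
    [P.IsPrime] {r m : ℕ} (D : Matrix (Fin r) (Fin m) S)
    (hD : r ≤ (D.map (algebraMap S P.ResidueField)).rank) :
    ∃ Δ ∉ P, ∃ M : Matrix (Fin m) (Fin r) S, D * M = Δ • (1 : Matrix (Fin r) (Fin r) S) := by
  have hsurj : Function.Surjective (D.map (algebraMap S P.ResidueField)).mulVec := by
    have : LinearMap.range (D.map (algebraMap S P.ResidueField)).mulVecLin = ⊤ := by
      apply Submodule.eq_top_of_finrank_eq
      refine le_antisymm (Submodule.finrank_le _) ?_
      simpa [Matrix.rank] using hD
    exact LinearMap.range_eq_top.mp this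
  obtain ⟨N, hN⟩ := Matrix.mulVec_surjective_iff_exists_right_inverse.mp hsurj
  obtain ⟨s, hs⟩ := IsLocalization.exist_integer_multiples_of_finite (nonZeroDivisors (S ⧸ P))
    (fun x : Fin m × Fin r => N x.1 x.2)
  choose g hg using hs
  choose g' hg' using fun x => Ideal.Quotient.mk_surjective (g x)
  obtain ⟨t, ht⟩ := Ideal.Quotient.mk_surjective (s : S ⧸ P)
  have htP : t ∉ P := by
    rw [← Ideal.Quotient.eq_zero_iff_mem, ht]
    exact nonZeroDivisors.ne_zero s.2
  have hN' : (Matrix.of fun i j => g' (i, j)).map (algebraMap S P.ResidueField) =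
      algebraMap S P.ResidueField t • N := by
    ext i j
    have := hg (i, j)
    rw [← hg' (i, j), ← ht, Algebra.smul_def] at this
    simpa using this
  set N' : Matrix (Fin m) (Fin r) S := Matrix.of fun i j => g' (i, j)
  -- `N'` lifts `t` times the right inverse, so `D * N'` reduces to the scalar matrix `t`. Its
  -- determinant is therefore nonzero modulo `P` and serves as `Δ`, with the adjugate completing the
  -- inverse.
  have hdet : algebraMap S P.ResidueField (D * N').det = algebraMap S P.ResidueField t ^ r := by
    rw [RingHom.map_det, RingHom.mapMatrix_apply, Matrix.map_mul, hN', Matrix.mul_smul, hN,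
      Matrix.det_smul, Matrix.det_one]
    simp
  refine ⟨(D * N').det, fun h => ?_, N' * (D * N').adjugate, ?_⟩
  · rw [Ideal.algebraMap_residueField_eq_zero.mpr h] at hdet
    exact htP (Ideal.algebraMap_residueField_eq_zero.mp (eq_zero_of_pow_eq_zero hdet.symm))
  · rw [← Matrix.mul_assoc, Matrix.mul_adjugate]

/-! ### The algebra k[Wt] and the special fiber -/

/-- For a subspace `W` of a `k`-algebra `S`, the subalgebra `k[W t]` of `S[t]`. -/
noncomputable abbrev Submodule.fiberAlgebra {k S : Type*} [Field k] [CommRing S] [Algebra k S]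
    (W : Submodule k S) : Subalgebra k (Polynomial S) :=
  Algebra.adjoin k (Polynomial.monomial 1 '' (W : Set S))

lemma Submodule.fiberAlgebra_le_reesAlgebra {k S : Type*} [Field k] [CommRing S] [Algebra k S]
    (W : Submodule k S) {x : Polynomial S} (hx : x ∈ W.fiberAlgebra) :
    x ∈ reesAlgebra (Ideal.span (W : Set S)) := by
  have : W.fiberAlgebra ≤ (reesAlgebra (Ideal.span (W : Set S))).restrictScalars k := by
    refine Algebra.adjoin_le ?_
    rintro _ ⟨w, hw, rfl⟩
    exact reesAlgebra.monomial_mem.mpr (by simpa using Ideal.subset_span hw)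
  exact this hx

instance Submodule.isNoetherianRing_fiberAlgebra {k S : Type*} [Field k] [CommRing S] [Algebra k S]
    (W : Submodule k S) [FiniteDimensional k W] : IsNoetherianRing W.fiberAlgebra := by
  obtain ⟨s, hs⟩ : W.FG := Module.Finite.iff_fg.mp inferInstance
  refine isNoetherianRing_of_fg (Subalgebra.fg_def.mpr
    ⟨Polynomial.monomial 1 '' (s : Set S), s.finite_toSet.image _, ?_⟩)
  refine le_antisymm (Algebra.adjoin_mono (Set.image_mono (hs ▸ Submodule.subset_span)))
    (Algebra.adjoin_le ?_)
  rintro _ ⟨w, hw, rfl⟩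
  rw [← hs] at hw
  have hmap := Submodule.mem_map_of_mem
    (f := (Polynomial.monomial 1 : S →ₗ[S] Polynomial S).restrictScalars k) hw
  rw [Submodule.map_span] at hmap
  exact Algebra.span_le_adjoin _ _ hmap

section MvPolynomial

variable {k σ : Type*} [Field k] {W : Submodule k (MvPolynomial σ k)} {d : ℕ}

lemma Submodule.coeff_isHomogeneous_of_mem_fiberAlgebra
    (hWd : W ≤ MvPolynomial.homogeneousSubmodule σ k d) {x : Polynomial (MvPolynomial σ k)}
    (hx : x ∈ W.fiberAlgebra) : ∀ j, (x.coeff j).IsHomogeneous (d * j) := by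
  induction hx using Algebra.adjoin_induction with
  | mem x hx =>
    obtain ⟨w, hw, rfl⟩ := hx
    intro j
    rw [Polynomial.coeff_monomial]
    split_ifs with h
    · subst h
      simpa using hWd hw
    · exact MvPolynomial.isHomogeneous_zero _ _ _
  | algebraMap c =>
    intro j
    rw [Polynomial.algebraMap_apply, Polynomial.coeff_C]
    split_ifs with h
    · subst h
      simpa using MvPolynomial.isHomogeneous_C σ c
    · exact MvPolynomial.isHomogeneous_zero _ _ _
  | add x y _ _ hx hy =>
    intro j
    rw [Polynomial.coeff_add]
    exact (hx j).add (hy j)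
  | mul x y _ _ hx hy =>
    intro j
    rw [Polynomial.coeff_mul]
    refine MvPolynomial.IsHomogeneous.sum _ _ _ fun ij hij => ?_
    rw [← Finset.HasAntidiagonal.mem_antidiagonal.mp hij, mul_add]
    exact (hx _).mul (hy _)

lemma MvPolynomial.span_le_pow_idealOfVars
    (hWd : W ≤ MvPolynomial.homogeneousSubmodule σ k d) :
    Ideal.span (W : Set (MvPolynomial σ k)) ≤ MvPolynomial.idealOfVars σ k ^ d := by
  refine Ideal.span_le.mpr fun w hw => ?_
  rw [SetLike.mem_coe, MvPolynomial.mem_pow_idealOfVars_iff']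
  exact fun x hx => (hWd hw).coeff_eq_zero hx.ne

/-- The coefficient of $t^j$ in the Rees algebra lies in $I^j$, hence has order at least $dj$, and a
factor from $\mathfrak m$ raises this by one. Coefficients from $k[Wt]$ are forms of degree exactly
$dj$, so $k[Wt]$ meets $\mathfrak m\mathcal R$ only in 0. -/
lemma MvPolynomial.coeff_mem_pow_idealOfVars_of_mem_map
    (hWd : W ≤ MvPolynomial.homogeneousSubmodule σ k d)
    {x : reesAlgebra (Ideal.span (W : Set (MvPolynomial σ k)))}
    (hx : x ∈ (MvPolynomial.idealOfVars σ k).map (algebraMap (MvPolynomial σ k)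
      (reesAlgebra (Ideal.span (W : Set (MvPolynomial σ k)))))) :
    ∀ j : ℕ, (x : Polynomial (MvPolynomial σ k)).coeff j ∈ MvPolynomial.idealOfVars σ k ^ (d * j + 1) := by
  induction hx using Submodule.span_induction with
  | mem x hx =>
    obtain ⟨s, hs, rfl⟩ := hx
    intro j
    have : ((algebraMap (MvPolynomial σ k)
      (reesAlgebra (Ideal.span (W : Set (MvPolynomial σ k)))) s :
        reesAlgebra (Ideal.span (W : Set (MvPolynomial σ k)))) : Polynomial (MvPolynomial σ k)) =
        Polynomial.C s := rfl
    rw [this, Polynomial.coeff_C]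
    split_ifs with h
    · subst h
      simpa using hs
    · exact Ideal.zero_mem _
  | zero => simp
  | add x y _ _ hx hy => simpa using fun j => Ideal.add_mem _ (hx j) (hy j)
  | smul a x _ hx =>
    intro j
    rw [smul_eq_mul, Subalgebra.coe_mul, Polynomial.coeff_mul]
    refine Ideal.sum_mem _ fun ij hij => ?_
    rw [← Finset.HasAntidiagonal.mem_antidiagonal.mp hij, mul_add, add_assoc, pow_add]
    refine Ideal.mul_mem_mul ?_ (hx _)
    rw [pow_mul]
    exact Ideal.pow_right_mono (MvPolynomial.span_le_pow_idealOfVars hWd) _ (a.2 _)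

/-- The special fiber ring of an ideal generated by a space `W` of forms of the same degree is
`k[W t]`. -/
lemma MvPolynomial.specialFiberRing_equiv_fiberAlgebra
    (hWd : W ≤ MvPolynomial.homogeneousSubmodule σ k d) :
    Nonempty (W.fiberAlgebra ≃+* Ideal.SpecialFiberRing (MvPolynomial.idealOfVars σ k)
      (Ideal.span (W : Set (MvPolynomial σ k)))) := by
  set I := Ideal.span (W : Set (MvPolynomial σ k)) with hI
  let ψ : W.fiberAlgebra →+* reesAlgebra I :=
    W.fiberAlgebra.val.toRingHom.codRestrict (reesAlgebra I)
      fun x => W.fiberAlgebra_le_reesAlgebra x.2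
  let mk : reesAlgebra I →+* _ := Ideal.Quotient.mk ((MvPolynomial.idealOfVars σ k).map
    (algebraMap (MvPolynomial σ k) (reesAlgebra I)))
  refine ⟨RingEquiv.ofBijective (mk.comp ψ) ⟨?_, ?_⟩⟩
  · rw [injective_iff_map_eq_zero]
    intro x hx
    have hx' := MvPolynomial.coeff_mem_pow_idealOfVars_of_mem_map hWd
      (Ideal.Quotient.eq_zero_iff_mem.mp hx)
    have hh := Submodule.coeff_isHomogeneous_of_mem_fiberAlgebra hWd x.2
    ext j e
    have hx'' : (x : Polynomial (MvPolynomial σ k)).coeff j ∈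
      MvPolynomial.idealOfVars σ k ^ (d * j + 1) := hx' j
    rw [MvPolynomial.mem_pow_idealOfVars_iff'] at hx''
    by_cases he : e.degree = d * j
    · simpa using hx'' e (by omega)
    · simpa using (hh j).coeff_eq_zero he
  -- Surjectivity: modulo $\mathfrak m$ a polynomial equals its constant term, so coefficients from
  -- $S$ reduce to scalars in $k$.
  · have hconst : ∀ s : MvPolynomial σ k, mk (algebraMap _ (reesAlgebra I) s) ∈ (mk.comp ψ).range := by
      intro s
      refine ⟨algebraMap k _ (MvPolynomial.constantCoeff s), ?_⟩
      have : ψ (algebraMap k _ (MvPolynomial.constantCoeff s)) =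
        algebraMap (MvPolynomial σ k) (reesAlgebra I) (MvPolynomial.C (MvPolynomial.constantCoeff s)) := rfl
      rw [RingHom.comp_apply, this, Ideal.Quotient.eq, ← map_sub]
      refine Ideal.mem_map_of_mem _ ?_
      rw [← pow_one (MvPolynomial.idealOfVars σ k), MvPolynomial.mem_pow_idealOfVars_iff']
      intro e he
      obtain rfl : e = 0 := (Finsupp.degree_eq_zero_iff e).mp (Nat.lt_one_iff.mp he)
      simp [MvPolynomial.constantCoeff_eq]
    have hlin : ∀ a ∈ I, ∀ h : Polynomial.monomial 1 a ∈ reesAlgebra I,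
        mk ⟨Polynomial.monomial 1 a, h⟩ ∈ (mk.comp ψ).range := by
      intro a ha
      induction ha using Submodule.span_induction with
      | mem w hw =>
        exact fun h => ⟨⟨Polynomial.monomial 1 w, Algebra.subset_adjoin ⟨w, hw, rfl⟩⟩, rfl⟩
      | zero =>
        intro h
        convert (mk.comp ψ).range.zero_mem
        convert map_zero mk
        simp
      | add x y hx hy hx' hy' =>
        intro h
        have hx1 : Polynomial.monomial 1 x ∈ reesAlgebra I :=
          reesAlgebra.monomial_mem.mpr (by simpa using hx)
        have hy1 : Polynomial.monomial 1 y ∈ reesAlgebra I :=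
          reesAlgebra.monomial_mem.mpr (by simpa using hy)
        convert (mk.comp ψ).range.add_mem (hx' hx1) (hy' hy1)
        rw [← map_add]
        congr 1
        ext1
        simp
      | smul s x hx hx' =>
        intro h
        have hx1 : Polynomial.monomial 1 x ∈ reesAlgebra I :=
          reesAlgebra.monomial_mem.mpr (by simpa using hx)
        convert (mk.comp ψ).range.mul_mem (hconst s) (hx' hx1)
        rw [← map_mul]
        congr 1
        ext1
        change _ = Polynomial.C s * Polynomial.monomial 1 x
        simp [Polynomial.C_mul_monomial]
    have hall : ∀ x ∈ Algebra.adjoin (MvPolynomial σ k) (Submodule.map (Polynomial.monomial 1 :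
        MvPolynomial σ k →ₗ[MvPolynomial σ k] Polynomial (MvPolynomial σ k)) I :
        Set (Polynomial (MvPolynomial σ k))), ∀ h : x ∈ reesAlgebra I,
        mk ⟨x, h⟩ ∈ (mk.comp ψ).range := by
      intro x hx
      induction hx using Algebra.adjoin_induction with
      | mem x hx =>
        obtain ⟨a, ha, rfl⟩ := hx
        exact hlin a ha
      | algebraMap s => exact fun _ => hconst s
      | add x y hx hy hx' hy' =>
        rw [adjoin_monomial_eq_reesAlgebra] at hx hy
        exact fun _ => (mk.comp ψ).range.add_mem (hx' hx) (hy' hy)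
      | mul x y hx hy hx' hy' =>
        rw [adjoin_monomial_eq_reesAlgebra] at hx hy
        exact fun _ => (mk.comp ψ).range.mul_mem (hx' hx) (hy' hy)
    intro y
    obtain ⟨x, rfl⟩ := Ideal.Quotient.mk_surjective y
    exact hall x (by rw [adjoin_monomial_eq_reesAlgebra]; exact x.2) x.2

end MvPolynomial

/-! ### The dimension bound for k[Wt] -/

open Polynomial in
lemma Submodule.exists_coeff_zero_of_mem_fiberAlgebra {k S : Type*} [Field k] [CommRing S]
    [Algebra k S] {W : Submodule k S} {x : S[X]} (hx : x ∈ W.fiberAlgebra) :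
    ∃ c : k, x.coeff 0 = algebraMap k S c := by
  induction hx using Algebra.adjoin_induction with
  | mem x hx =>
    obtain ⟨w, hw, rfl⟩ := hx
    exact ⟨0, by simp [coeff_monomial]⟩
  | algebraMap c => exact ⟨c, by simp [Polynomial.algebraMap_apply]⟩
  | add x y _ _ hx hy =>
    obtain ⟨a, ha⟩ := hx
    obtain ⟨b, hb⟩ := hy
    exact ⟨a + b, by simp [ha, hb]⟩
  | mul x y _ _ hx hy =>
    obtain ⟨a, ha⟩ := hx
    obtain ⟨b, hb⟩ := hy
    exact ⟨a * b, by simp [ha, hb, mul_coeff_zero]⟩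

open Polynomial in
/-- A minimal prime of the ideal of a subspace `V ⊆ W` that does not contain `W` has height less
than the dimension of `k[W t]`. -/
lemma Submodule.height_add_one_le_ringKrullDim_fiberAlgebra {k S : Type*} [Field k] [CommRing S]
    [IsDomain S] [IsNoetherianRing S] [Algebra k S] (W V : Submodule k S) [FiniteDimensional k W]
    (hVW : V ≤ W) (Q : Ideal S) (hQ : Q ∈ (Ideal.span (V : Set S)).minimalPrimes) {w₀ : S}
    (hw₀ : w₀ ∈ W) (hw₀Q : w₀ ∉ Q) :
    ((Q.height + 1 : ℕ∞) : WithBot ℕ∞) ≤ ringKrullDim W.fiberAlgebra := by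
  have hQp : Q.IsPrime := hQ.1.1
  let q : Ideal S[X] := Q.map C
  let p : Ideal W.fiberAlgebra := q.comap (algebraMap W.fiberAlgebra S[X])
  -- Let `q'` be a prime between the extension of `p` and `q`. It contains $wX$ for $w \in V$ but
  -- not $X$, so its contraction to $S$ contains $V$ and, by minimality of `Q`, contains `Q`.
  have hqmin : q ∈ (p.map (algebraMap W.fiberAlgebra S[X])).minimalPrimes := by
    refine ⟨⟨Ideal.isPrime_map_C_of_isPrime, Ideal.map_comap_le⟩, fun q' ⟨hq', hle⟩ hq'q => ?_⟩
    have hX : X ∉ q' := fun h => hQp.one_notMem (by simpa using Ideal.mem_map_C_iff.mp (hq'q h) 1)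
    refine Ideal.map_le_iff_le_comap.mpr (hQ.2 ⟨hq'.comap C, Ideal.span_le.mpr fun w hw => ?_⟩ ?_)
    · have hwp : (⟨monomial 1 w, Algebra.subset_adjoin ⟨w, hVW hw, rfl⟩⟩ : W.fiberAlgebra) ∈ p := by
        refine Ideal.mem_comap.mpr (Ideal.mem_map_C_iff.mpr fun j => ?_)
        change (monomial 1 w).coeff j ∈ Q
        rw [coeff_monomial]
        split_ifs
        · exact hQ.1.2 (Ideal.subset_span hw)
        · exact Q.zero_mem
      have hmem : monomial 1 w ∈ q' := hle (Ideal.mem_map_of_mem _ hwp)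
      rw [← C_mul_X_eq_monomial] at hmem
      exact (hq'.mem_or_mem hmem).resolve_right hX
    · intro s hs
      simpa using Ideal.mem_map_C_iff.mp (hq'q (Ideal.mem_comap.mp hs)) 0
  have hqp : q.IsPrime := hqmin.1.1
  -- The irrelevant ideal. It contains `p` because constant terms of $k[Wt]$ lie in $k$ and $k \cap
  -- Q = 0$; $w_0 X$ makes the inclusion strict.
  let M : Ideal W.fiberAlgebra :=
    RingHom.ker ((constantCoeff (R := S)).comp (algebraMap W.fiberAlgebra S[X]))
  have hMp : M.IsPrime := RingHom.ker_isPrime _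
  have hlt : p < M := by
    refine lt_of_le_of_ne (fun x hx => ?_) fun h => ?_
    · obtain ⟨c, hc⟩ := Submodule.exists_coeff_zero_of_mem_fiberAlgebra x.2
      have h0 : (x : S[X]).coeff 0 ∈ Q := Ideal.mem_map_C_iff.mp (Ideal.mem_comap.mp hx) 0
      change (x : S[X]).coeff 0 = 0
      rw [hc] at h0 ⊢
      by_cases hc0 : c = 0
      · simp [hc0]
      · exact absurd (Ideal.eq_top_of_isUnit_mem _ h0 ((IsUnit.mk0 c hc0).map _)) hQp.ne_top
    · have hM : (⟨monomial 1 w₀, Algebra.subset_adjoin ⟨w₀, hw₀, rfl⟩⟩ : W.fiberAlgebra) ∈ M := by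
        change (monomial 1 w₀).coeff 0 = 0
        simp [coeff_monomial]
      rw [← h] at hM
      have := Ideal.mem_map_C_iff.mp (Ideal.mem_comap.mp hM) 1
      exact hw₀Q (by simpa [Subalgebra.algebraMap_def] using this)
  have hpp : p.IsPrime := inferInstance
  have h1 : Q.height ≤ p.height :=
    (Ideal.height_le_height_map_C Q).trans
      (Ideal.height_le_height_comap_of_mem_minimalPrimes q hqmin)
  have h2 : Q.height + 1 ≤ M.height :=
    (add_le_add_left h1 1).trans (Ideal.height_add_one_le_of_lt_of_isPrime hlt)
  exact (WithBot.coe_le_coe.mpr h2).trans Ideal.height_le_ringKrullDim_of_isPrime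

/-! ### Local structure of the syzygies at P -/

/-- If the generalized row ideal at `Wq` lies in a prime `P` at which the syzygy matrix `A` has
rank `r`, then up to a denominator outside `P` the forms in `Wq` are multiples of a form `w₀`
outside `Wq`, with multipliers in the generalized row ideal. -/
lemma exists_denominator_of_generalizedRowIdeal_le {k S : Type*} [Field k] [CommRing S]
    [Algebra k S] {r m : ℕ} {W : Submodule k S} (b : Module.Basis (Fin (r + 1)) k W)
    (A : Matrix (Fin (r + 1)) (Fin m) S) (hAsyz : ∀ j, ∑ i, A i j * (b i : S) = 0)
    (Wq : Submodule k W) (hWq : Module.finrank k (W ⧸ Wq) = 1) (P : Ideal S) [P.IsPrime]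
    (hAP : generalizedRowIdeal b Wq A ≤ P)
    (hrank : (A.map (algebraMap S P.ResidueField)).rank = r) :
    ∃ w₀ : W, (∀ w : W, ∃ c : k, w - c • w₀ ∈ Wq) ∧
      (∀ a ∈ generalizedRowIdeal b Wq A,
        a * (w₀ : S) ∈ Ideal.span (Wq.map W.subtype : Set S)) ∧
      ∃ Δ ∉ P, ∀ w ∈ Wq, ∃ a ∈ generalizedRowIdeal b Wq A, Δ * (w : S) = a * w₀ := by
  have : FiniteDimensional k W := b.finiteDimensional_of_finite
  have : FiniteDimensional k (W ⧸ Wq) := inferInstance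
  let e : (W ⧸ Wq) ≃ₗ[k] k := LinearEquiv.ofFinrankEq _ _ (by simp [hWq])
  obtain ⟨w₀, hw₀⟩ : ∃ w₀ : W, Wq.mkQ w₀ = e.symm 1 := Wq.mkQ_surjective _
  -- `μ` is the functional with kernel `Wq` normalised by `μ w₀ = 1`; `a` below is the corresponding
  -- generalized row.
  let μ : W →ₗ[k] k := e.toLinearMap ∘ₗ Wq.mkQ
  have hμw₀ : μ w₀ = 1 := by simp [μ, hw₀]
  have hsub : ∀ w : W, w - μ w • w₀ ∈ Wq := fun w => by
    rw [← Submodule.ker_mkQ Wq, LinearMap.mem_ker, ← e.map_eq_zero_iff]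
    change μ (w - μ w • w₀) = 0
    simp [hμw₀]
  let a : Fin m → S := fun j => ∑ i, μ (b i) • A i j
  have ha : ∀ j, a j ∈ generalizedRowIdeal b Wq A :=
    fun j => Ideal.subset_span ⟨e.toLinearMap, j, rfl⟩
  have hrel : ∀ j, a j * (w₀ : S) = -∑ i, A i j * ((b i - μ (b i) • w₀ : W) : S) := by
    intro j
    have : ∑ i, A i j * ((b i - μ (b i) • w₀ : W) : S) =
        ∑ i, A i j * (b i : S) - a j * (w₀ : S) := by
      rw [Finset.sum_mul, ← Finset.sum_sub_distrib]
      refine Finset.sum_congr rfl fun i _ => ?_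
      simp [mul_sub, Algebra.smul_def]
      ring
    rw [this, hAsyz]
    ring
  refine ⟨w₀, fun w => ⟨_, hsub w⟩, fun s hs => ?_, ?_⟩
  · induction hs using Submodule.span_induction with
    | mem s hs =>
      obtain ⟨l, j, rfl⟩ := hs
      have hl : ∀ w : W, l (Wq.mkQ w) = l (e.symm 1) * μ w := by
        intro w
        have : Wq.mkQ w = μ w • e.symm 1 := by
          rw [← map_smul, smul_eq_mul, mul_one]
          simp [μ]
        rw [this, map_smul, smul_eq_mul, mul_comm]
      have : ∑ i, l (Wq.mkQ (b i)) • A i j = l (e.symm 1) • a j := by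
        simp only [hl, mul_smul, a, Finset.smul_sum]
      rw [this, smul_mul_assoc, hrel, Algebra.smul_def]
      refine Ideal.mul_mem_left _ _ (neg_mem (Ideal.sum_mem _ fun i _ => ?_))
      exact Ideal.mul_mem_left _ _ (Ideal.subset_span ⟨_, hsub (b i), rfl⟩)
    | zero => simp
    | add x y _ _ hx hy => rw [add_mul]; exact Ideal.add_mem _ hx hy
    | smul c x _ hx => rw [smul_eq_mul, mul_assoc]; exact Ideal.mul_mem_left _ _ hx
  have hfin : Module.finrank k Wq = r := by
    have h1 := Submodule.finrank_quotient_add_finrank Wq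
    rw [hWq, Module.finrank_eq_card_basis b, Fintype.card_fin] at h1
    omega
  have hfree : Module.Free k Wq := Module.Free.of_divisionRing k Wq
  let v : Module.Basis (Fin r) k Wq := Module.finBasisOfFinrankEq k Wq hfin
  let c : Fin r → Fin (r + 1) → k := fun p i => v.repr ⟨_, hsub (b i)⟩ p
  have hc : ∀ i, ∑ p, c p i • (v p : W) = b i - μ (b i) • w₀ := by
    intro i
    have := congrArg (Subtype.val) (v.sum_repr ⟨_, hsub (b i)⟩)
    rw [Submodule.coe_sum] at this
    exact this
  let D : Matrix (Fin r) (Fin m) S := Matrix.of fun p j => ∑ i, c p i • A i j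
  have hrelD : ∀ j, ∑ p, D p j * ((v p : W) : S) = -(a j * (w₀ : S)) := by
    intro j
    rw [hrel, neg_neg]
    simp only [← hc, D, Matrix.of_apply, Finset.sum_mul, Submodule.coe_sum, Submodule.coe_smul,
      Finset.mul_sum]
    rw [Finset.sum_comm]
    simp
  let G : Matrix (Fin (r + 1)) (Fin r) S := Matrix.of fun i p => algebraMap k S (b.repr (v p) i)
  have hA : ∀ i j, A i j = algebraMap k S (b.repr w₀ i) * a j + (G * D) i j := by
    intro i j
    -- The `i`-th coordinate of the expansion of `b i'` in terms of `w₀` and the `v p`.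
    have hδ : ∀ i', (if i' = i then (1 : k) else 0) =
        μ (b i') * b.repr w₀ i + ∑ p, c p i' * b.repr (v p) i := by
      intro i'
      have := congrArg (fun w => b.repr w i) (hc i')
      simp [Finsupp.single_apply] at this
      rw [this]
      ring
    have hsum : A i j = ∑ i', (if i' = i then (1 : k) else 0) • A i' j := by simp
    rw [hsum]
    simp only [hδ, add_smul, Finset.sum_add_distrib, Matrix.mul_apply, G, D, a, Matrix.of_apply,
      Finset.mul_sum, Finset.sum_smul]
    congr 1
    · refine Finset.sum_congr rfl fun i' _ => ?_
      rw [← Algebra.smul_def, smul_smul, mul_comm]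
    · rw [Finset.sum_comm]
      refine Finset.sum_congr rfl fun p _ => Finset.sum_congr rfl fun i' _ => ?_
      rw [← Algebra.smul_def, smul_smul, mul_comm]
  -- Modulo `P` the `a`-term vanishes, so `A` factors through `D` and rank $r$ passes to `D`.
  have hAGD : A.map (algebraMap S P.ResidueField) =
      G.map (algebraMap S P.ResidueField) * D.map (algebraMap S P.ResidueField) := by
    rw [← Matrix.map_mul]
    ext i j
    rw [Matrix.map_apply, hA i j, map_add, map_mul,
      Ideal.algebraMap_residueField_eq_zero.mpr (hAP (ha j)), mul_zero, zero_add, Matrix.map_apply]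
  obtain ⟨Δ, hΔ, M, hM⟩ := Matrix.exists_mul_eq_smul_one_of_rank_residueField P D
    (by rw [hAGD] at hrank; exact hrank.symm.le.trans (Matrix.rank_mul_le_right _ _))
  have hv : ∀ p, Δ * ((v p : W) : S) = (-∑ j, M j p * a j) * w₀ := by
    intro p
    have h1 : ∑ j, M j p * ∑ p', D p' j * ((v p' : W) : S) = Δ * ((v p : W) : S) := by
      simp only [Finset.mul_sum]
      rw [Finset.sum_comm]
      have h2 : ∀ p', ∑ j, M j p * (D p' j * ((v p' : W) : S)) =
          (D * M) p' p * ((v p' : W) : S) := by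
        intro p'
        rw [Matrix.mul_apply, Finset.sum_mul]
        exact Finset.sum_congr rfl fun j _ => by ring
      simp only [h2, hM]
      simp [Matrix.one_apply]
    rw [← h1]
    simp only [hrelD, neg_mul, mul_neg, Finset.sum_neg_distrib, Finset.sum_mul, mul_assoc]
  refine ⟨Δ, hΔ, fun w hw => ?_⟩
  refine ⟨∑ p, algebraMap k S (v.repr ⟨w, hw⟩ p) * -∑ j, M j p * a j, ?_, ?_⟩
  · exact Ideal.sum_mem _ fun p _ => Ideal.mul_mem_left _ _
      (neg_mem (Ideal.sum_mem _ fun j _ => Ideal.mul_mem_left _ _ (ha j)))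
  · have hw' : (w : S) = ∑ p, algebraMap k S (v.repr ⟨w, hw⟩ p) * ((v p : W) : S) := by
      have := congrArg (fun x : Wq => ((x : W) : S)) (v.sum_repr ⟨w, hw⟩)
      simp only [Submodule.coe_sum, Submodule.coe_smul, Algebra.smul_def] at this
      exact this.symm
    nth_rw 1 [hw']
    rw [Finset.mul_sum, Finset.sum_mul]
    refine Finset.sum_congr rfl fun p _ => ?_
    rw [mul_left_comm, hv, mul_assoc]

/-! ### The main theorem -/

theorem mainTheorem4 {k : Type*} [Field k] [Infinite k] (n r d m : ℕ)
    (W : Submodule k (MvPolynomial (Fin (n + 1)) k))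
    (hWd : W ≤ MvPolynomial.homogeneousSubmodule (Fin (n + 1)) k d)
    (b : Module.Basis (Fin (r + 1)) k W)
    (I : Ideal (MvPolynomial (Fin (n + 1)) k))
    (hI : I = Ideal.span (W : Set (MvPolynomial (Fin (n + 1)) k)))
    (hcodim : 2 ≤ I.height)
    (A : Matrix (Fin (r + 1)) (Fin m) (MvPolynomial (Fin (n + 1)) k))
    (hAhom : ∀ i j, ∃ e : ℕ, (A i j).IsHomogeneous e)
    (hAsyz : ∀ j, ∑ i, A i j * (b i : MvPolynomial (Fin (n + 1)) k) = 0)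
    (Wq : Submodule k W) (hWq : Module.finrank k (W ⧸ Wq) = 1)
    (Iq : Ideal (MvPolynomial (Fin (n + 1)) k))
    (hIq : Iq = Ideal.span (Wq.map W.subtype : Set (MvPolynomial (Fin (n + 1)) k)))
    (hP : ∃ (P : Ideal (MvPolynomial (Fin (n + 1)) k)) (_ : P.IsPrime),
      generalizedRowIdeal b Wq A ≤ P ∧
        (A.map (algebraMap (MvPolynomial (Fin (n + 1)) k) P.ResidueField)).rank = r) :
    Iq.colonInfty I ≠ ⊤ ∧
      1 + ((generalizedRowIdeal b Wq A).height : WithBot ℕ∞) ≤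
        Ideal.analyticSpread (MvPolynomial.idealOfVars (Fin (n + 1)) k) I := by
  obtain ⟨P, hPp, hAP, hrank⟩ := hP
  have : FiniteDimensional k W := b.finiteDimensional_of_finite
  obtain ⟨w₀, hdec, hrow, Δ, hΔ, hden⟩ :=
    exists_denominator_of_generalizedRowIdeal_le b A hAsyz Wq hWq P hAP hrank
  have hw₀P : (w₀ : MvPolynomial (Fin (n + 1)) k) ∉ P := by
    intro hmem
    -- Since `Δ ∉ Q`, the relations `Δ w = a w₀` put all of `Wq`, hence `I`, into this prime of
    -- height at most one.
    obtain ⟨Q, hQ, hQP⟩ := Ideal.exists_minimalPrimes_le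
      ((Ideal.span_singleton_le_iff_mem P).mpr hmem)
    have hQp : Q.IsPrime := hQ.1.1
    have hw₀Q : (w₀ : MvPolynomial (Fin (n + 1)) k) ∈ Q := hQ.1.2 (Ideal.mem_span_singleton_self _)
    have hWqQ : ∀ w ∈ Wq, (w : MvPolynomial (Fin (n + 1)) k) ∈ Q := by
      intro w hw
      obtain ⟨a, -, ha⟩ := hden w hw
      exact (hQp.mem_or_mem (ha ▸ Q.mul_mem_left a hw₀Q)).resolve_left fun h => hΔ (hQP h)
    have hIQ : I ≤ Q := by
      rw [hI, Ideal.span_le]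
      intro w hw
      obtain ⟨c, hc⟩ := hdec ⟨w, hw⟩
      have h1 := Q.add_mem (hWqQ _ hc) (Submodule.smul_of_tower_mem Q c hw₀Q)
      simpa using h1
    have h1 := Ideal.height_le_one_of_isPrincipal_of_mem_minimalPrimes _ _ hQ
    exact absurd ((hcodim.trans (Ideal.height_mono hIQ)).trans h1) (by decide)
  refine ⟨fun htop => ?_, ?_⟩
  · obtain ⟨i, hi⟩ := Ideal.mem_colonInfty.mp ((Ideal.eq_top_iff_one _).mp htop)
    have hIqP : Iq ≤ P := by
      rw [hIq, Ideal.span_le]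
      rintro _ ⟨w, hw, rfl⟩
      obtain ⟨a, ha, h⟩ := hden w hw
      exact (hPp.mem_or_mem (h ▸ P.mul_mem_right _ (hAP ha))).resolve_left hΔ
    have hw₀I : (w₀ : MvPolynomial (Fin (n + 1)) k) ∈ I := hI ▸ Ideal.subset_span w₀.2
    have := hIqP (hi _ (Ideal.pow_mem_pow hw₀I i))
    rw [one_mul] at this
    exact hw₀P (hPp.mem_of_pow_mem i this)
  · obtain ⟨Q, hQ, hQP⟩ := Ideal.exists_minimalPrimes_le hAP
    have hQp : Q.IsPrime := hQ.1.1
    have hw₀Q : (w₀ : MvPolynomial (Fin (n + 1)) k) ∉ Q := fun h => hw₀P (hQP h)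
    -- Inside `Q`, neither `Δ` nor `w₀` occurs, so $\Delta I_q \subseteq A_q$ and $A_q w_0 \subseteq
    -- I_q$ give the same primes contained in `Q`.
    have hQmin : Q ∈ (Ideal.span
        (Wq.map W.subtype : Set (MvPolynomial (Fin (n + 1)) k))).minimalPrimes := by
      refine ⟨⟨hQp, Ideal.span_le.mpr ?_⟩, fun Q' ⟨hQ', hle⟩ hQ'Q => hQ.2 ⟨hQ', fun a ha => ?_⟩ hQ'Q⟩
      · rintro _ ⟨w, hw, rfl⟩
        obtain ⟨a, ha, h⟩ := hden w hw
        exact (hQp.mem_or_mem (h ▸ Q.mul_mem_right _ (hQ.1.2 ha))).resolve_left fun h => hΔ (hQP h)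
      · exact (hQ'.mem_or_mem (hle (hrow a ha))).resolve_right fun h => hw₀Q (hQ'Q h)
    obtain ⟨e⟩ := MvPolynomial.specialFiberRing_equiv_fiberAlgebra hWd
    have hdim := Submodule.height_add_one_le_ringKrullDim_fiberAlgebra W (Wq.map W.subtype)
      (Submodule.map_subtype_le W Wq) Q hQmin w₀.2 hw₀Q
    have he : ringKrullDim W.fiberAlgebra = ringKrullDim (Ideal.SpecialFiberRing
        (MvPolynomial.idealOfVars (Fin (n + 1)) k)
        (Ideal.span (W : Set (MvPolynomial (Fin (n + 1)) k)))) := ringKrullDim_eq_of_ringEquiv e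
    rw [he] at hdim
    rw [hI, Ideal.analyticSpread]
    refine le_trans ?_ hdim
    rw [add_comm, ← WithBot.coe_one, ← WithBot.coe_add, WithBot.coe_le_coe]
    exact add_le_add_left (Ideal.height_mono hQ.1.2) 1
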